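/- Let $\mathcal G$ be a finite simple undirected connected graph with vertex set $\mathcal V$, $N=|\mathcal V|$, let $L=D-A$ be its Laplacian matrix, and let $\lambda_i$ ($i=0,\dots,N-1$) be the eigenvalues of $L$, counted with multiplicity, with $0=\lambda_0<\lambda_1\le\dots\le\lambda_{N-1}$. Consider the noisy second-order consensus dynamics $$\begin{bmatrix}\dot x_1(t)\\ \dot x_2(t)\end{bmatrix}=\begin{bmatrix}0&I\\-L&-L\end{bmatrix}\begin{bmatrix}x_1(t)\\x_2(t)\end{bmatrix}+\begin{bmatrix}0\\I\end{bmatrix}w(t),\qquad t\ge 0,$$ where $w$ is an $N$-vector of uncorrelated Gaussian white noise processes of unit intensity. That is, $w=\dot W$, where the coordinates of $W$ are standard Brownian motions, mutually uncorrelated, and $x=(x_1,x_2)$ is a process with almost surely continuous paths that satisfies the time-integrated equation almost surely for all $t\ge 0$. Let the initial state $x(0)$ be square-integrable, and let $\bar x_1(t)=\frac1N\sum_{j\in\mathcal V}x_{1j}(t)$. Then all deviations $x_{1j}(t)-\bar x_1(t)$ are square-integrable, and the total steady-state variance $$H_{\mathrm{SO}}(\mathcal G)=\lim_{t\to\infty}\sum_{j\in\mathcal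 V}\mathbb E\left[\left(x_{1j}(t)-\bar x_1(t)\right)^2\right]$$ exists and equals $$H_{\mathrm{SO}}(\mathcal G)=\sum_{i=1}^{N-1}\frac{1}{2\lambda_i^2},$$ the sum over the nonzero eigenvalues of $L$. -/

import Mathlib

open MeasureTheory ProbabilityTheory Filter Topology
open scoped NNReal

namespace SecondOrderConsensus

section Dynamics

variable {V : Type*} [Fintype V] [DecidableEq V]

/-- The `2N × 2N` drift matrix with blocks `0, I` in the first row and `-L, -L` in the second row,
where `L` is the Laplacian matrix of `G`. The first copy of `V` indexes the states `x₁`,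
the second copy their derivatives `x₂`. -/
def driftMatrix (G : SimpleGraph V) [DecidableRel G.Adj] : Matrix (V ⊕ V) (V ⊕ V) ℝ :=
  Matrix.fromBlocks 0 1 (-G.lapMatrix ℝ) (-G.lapMatrix ℝ)

variable (V) in
/-- The `2N × N` noise input matrix with blocks `0` (above) and `I` (below). -/
def noiseMatrix : Matrix (V ⊕ V) V ℝ :=
  Matrix.fromRows 0 1

variable {Ω : Type*} [MeasurableSpace Ω]

/-- The integrated noise `W = ∫ w` of a vector `w` of uncorrelated standard Gaussian white noises:
every coordinate is a standard Brownian motion (`W j t` has variance `t`), and different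
coordinates are uncorrelated (for instance independent). -/
structure IsUncorrelatedBrownian (W : V → ℝ≥0 → Ω → ℝ) (P : Measure Ω) : Prop where
  brownian : ∀ j, IsBrownianReal (W j) P
  uncorrelated : ∀ i j, i ≠ j → ∀ s t, cov[W i s, W j t; P] = 0

/-- `x = (x₁, x₂)` is a solution of the linear stochastic system `ẋ = M x + B w` with drift matrix
`M` and noise input matrix `B`, driven by the integrated noise `W = ∫ w`: almost surely the path is
continuous and `x(t) = x(0) + ∫₀ᵗ M x(s) ds + B W(t)` for all `t ≥ 0`. (The noise is additive, so
the stochastic integral `∫₀ᵗ B dW` is `B W(t)`.) -/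
structure IsSolution (G : SimpleGraph V) [DecidableRel G.Adj]
    (x : ℝ≥0 → Ω → V ⊕ V → ℝ) (W : V → ℝ≥0 → Ω → ℝ) (P : Measure Ω) : Prop where
  continuous_paths : ∀ᵐ ω ∂P, Continuous fun t => x t ω
  integral_eq : ∀ᵐ ω ∂P, ∀ (t : ℝ≥0) (i : V ⊕ V),
    x t ω i = x 0 ω i
      + (∫ s in (0 : ℝ)..(t : ℝ), (Matrix.mulVec (driftMatrix G) (x s.toNNReal ω)) i)
      + (Matrix.mulVec (noiseMatrix V) fun j => W j t ω) i

end Dynamics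

section Variance

variable {V : Type*} [Fintype V] {Ω : Type*} [MeasurableSpace Ω]

/-- The average `x̄₁(t) = (1/N) ∑ⱼ x₁ⱼ(t)` of the vertex states. -/
noncomputable def averageState (x : ℝ≥0 → Ω → V ⊕ V → ℝ) (t : ℝ≥0) (ω : Ω) : ℝ :=
  (1 / (Fintype.card V : ℝ)) * ∑ j : V, x t ω (Sum.inl j)

/-- The deviation `yⱼ(t) = x₁ⱼ(t) - x̄₁(t)` of the state of vertex `j` from the current average. -/
noncomputable def deviation (x : ℝ≥0 → Ω → V ⊕ V → ℝ) (j : V) (t : ℝ≥0) (ω : Ω) : ℝ :=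
  x t ω (Sum.inl j) - averageState x t ω

/-- The total steady-state variance of the process `x` exists and equals `H`: all deviations from
the average have finite second moments, and `∑ⱼ E[(x₁ⱼ(t) - x̄₁(t))²] → H` as `t → ∞`. -/
def HasTotalVariance (x : ℝ≥0 → Ω → V ⊕ V → ℝ) (P : Measure Ω) (H : ℝ) : Prop :=
  (∀ j t, MemLp (deviation x j t) 2 P) ∧
    Tendsto (fun t : ℝ≥0 => ∑ j : V, ∫ ω, deviation x j t ω ^ 2 ∂P) atTop (𝓝 H)

end Variance

end SecondOrderConsensus

/-! The symmetric matrix L has an orthonormal eigenbasis. In these coordinates the system decouples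
into scalar oscillators z'' + l z' + l z = b', one per eigenvalue l, each driven by noise with
covariance min(s, t). Since the graph is connected, subtracting the average removes exactly the
modes with l = 0, and by Parseval the total variance is the sum of the second moments of the
remaining modes.

For l > 0 let g be the impulse response and h = g'. Integrating the noise term by parts replaces ∫
g(t-s) db(s) by the pathwise integral ∫ h(t-s) b(s) ds (`IsImpulseResponse.variation_of_constants`),
so no stochastic integral is needed. By Fubini and the covariance min(s, r), its second moment is
∫₀ᵗ g² (`integral_mul_integral_mul_min`). An explicit antiderivative of g² and the decay of g and h
give the limit 1 / (2 l²). The initial data enter with decaying coefficients, so their contribution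
vanishes even if they are correlated with the noise. -/

namespace SecondOrderConsensus

/-! ### The deterministic scalar oscillator -/

/-- The impulse response `g` of `z'' + l z' + l z = 0`, together with its derivative `h`. -/
structure IsImpulseResponse (l : ℝ) (g h : ℝ → ℝ) : Prop where
  zero_left : g 0 = 0
  zero_right : h 0 = 1
  deriv_left : ∀ t, HasDerivAt g (h t) t
  deriv_right : ∀ t, HasDerivAt h (-l * g t - l * h t) t

lemma exists_isImpulseResponse (l : ℝ) : ∃ g h : ℝ → ℝ, IsImpulseResponse l g h := by
  let A : ℝ × ℝ →L[ℝ] ℝ × ℝ := (ContinuousLinearMap.snd ℝ ℝ ℝ).prod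
    ((-l) • ContinuousLinearMap.fst ℝ ℝ ℝ - l • ContinuousLinearMap.snd ℝ ℝ ℝ)
  have hA (t : ℝ) : HasDerivAt (fun u : ℝ => NormedSpace.exp (u • A) (0, 1))
      (A (NormedSpace.exp (t • A) (0, 1))) t := by
    simpa using (hasDerivAt_exp_smul_const' A t).clm_apply (hasDerivAt_const t ((0 : ℝ), (1 : ℝ)))
  refine ⟨fun t => (NormedSpace.exp (t • A) (0, 1)).1,
    fun t => (NormedSpace.exp (t • A) (0, 1)).2, by simp, by simp, fun t => ?_, fun t => ?_⟩
  · exact hasFDerivAt_fst.comp_hasDerivAt t (hA t)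
  · exact hasFDerivAt_snd.comp_hasDerivAt t (hA t)

namespace IsImpulseResponse

variable {l : ℝ} {g h : ℝ → ℝ}

lemma continuous_left (H : IsImpulseResponse l g h) : Continuous g :=
  continuous_iff_continuousAt.2 fun t => (H.deriv_left t).continuousAt

lemma continuous_right (H : IsImpulseResponse l g h) : Continuous h :=
  continuous_iff_continuousAt.2 fun t => (H.deriv_right t).continuousAt

/-- Exponential decay, from the Lyapunov function
`(h + l g)² / (2 l) + g² / 2 + h² + l g²`. -/
lemma exists_sq_add_sq_le (H : IsImpulseResponse l g h) (hl : 0 < l) :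
    ∃ C c : ℝ, 0 < c ∧ ∀ t, 0 ≤ t → g t ^ 2 + h t ^ 2 ≤ C * Real.exp (-c * t) := by
  -- The first two terms together have derivative -l g², the last two -2 l h²; the sum therefore
  -- dissipates both variables.
  let R : ℝ → ℝ := fun t => (h t + l * g t) ^ 2 / (2 * l) + g t ^ 2 / 2 + h t ^ 2 + l * g t ^ 2
  have hR (t : ℝ) : HasDerivAt R (-l * g t ^ 2 - 2 * l * h t ^ 2) t := by
    have h1 := H.deriv_left t
    have h2 := H.deriv_right t
    have h3 := ((((h2.add (h1.const_mul l)).pow 2).div_const (2 * l)).add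
      ((h1.pow 2).div_const 2)).add (h2.pow 2) |>.add ((h1.pow 2).const_mul l)
    refine h3.congr_deriv ?_
    simp only [Pi.add_apply]
    field_simp
    push_cast
    ring
  -- K adds up the coefficients left after (h + l g)² ≤ 2 h² + 2 l² g². Then R ≤ K (g² + h²) gives
  -- R' ≤ -(l / K) R.
  set K : ℝ := 1 / l + l + 1 / 2 + 1 + l with hK
  have hKpos : 0 < K := by positivity
  set c : ℝ := l / K with hc
  have hcpos : 0 < c := by positivity
  have hRle (t : ℝ) : R t ≤ K * (g t ^ 2 + h t ^ 2) := by
    have e : (h t + l * g t) ^ 2 / (2 * l) ≤ h t ^ 2 / l + l * g t ^ 2 := by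
      rw [div_le_iff₀ (by positivity)]
      have : (h t ^ 2 / l + l * g t ^ 2) * (2 * l) = 2 * h t ^ 2 + 2 * (l * g t) ^ 2 := by
        field_simp
      rw [this]
      nlinarith [sq_nonneg (h t - l * g t)]
    have e2 : 0 ≤ 1 / l * g t ^ 2 := by positivity
    have e3 : 0 ≤ l * h t ^ 2 := by positivity
    have e4 : h t ^ 2 / l = 1 / l * h t ^ 2 := by ring
    simp only [R]
    rw [hK]
    nlinarith [sq_nonneg (g t), sq_nonneg (h t)]
  have hanti : Antitone fun t => R t * Real.exp (c * t) := by
    refine antitone_of_hasDerivAt_nonpos (f' := fun t =>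
      (-l * g t ^ 2 - 2 * l * h t ^ 2) * Real.exp (c * t) +
        R t * (Real.exp (c * t) * (c * 1))) (fun t => ?_) (fun t => ?_)
    · exact (hR t).mul ((hasDerivAt_id t).const_mul c).exp
    · have h1 : c * R t ≤ l * (g t ^ 2 + h t ^ 2) := by
        calc c * R t ≤ c * (K * (g t ^ 2 + h t ^ 2)) := by gcongr; exact hRle t
          _ = _ := by rw [hc]; field_simp
      have h2 := Real.exp_pos (c * t)
      have h3 : -l * g t ^ 2 - 2 * l * h t ^ 2 + c * R t ≤ 0 := by
        nlinarith [sq_nonneg (h t)]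
      simp only [Pi.zero_apply]
      nlinarith
  -- The factor 1 + 2 comes from h² ≤ R and g² ≤ 2 R.
  refine ⟨R 0 * (1 + 2), c, hcpos, fun t ht => ?_⟩
  have h1 : R t * Real.exp (c * t) ≤ R 0 := by simpa using hanti ht
  have h2 : R t ≤ R 0 * Real.exp (-c * t) := by
    rw [neg_mul, Real.exp_neg, ← div_eq_mul_inv, le_div_iff₀ (Real.exp_pos _)]
    exact h1
  have h3 : g t ^ 2 + h t ^ 2 ≤ R t * (1 + 2) := by
    have : 0 ≤ (h t + l * g t) ^ 2 / (2 * l) := by positivity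
    have : 0 ≤ l * g t ^ 2 := by positivity
    simp only [R]
    nlinarith [sq_nonneg (g t), sq_nonneg (h t)]
  nlinarith

lemma tendsto_left (H : IsImpulseResponse l g h) (hl : 0 < l) : Tendsto g atTop (𝓝 0) ∧
    Tendsto h atTop (𝓝 0) := by
  obtain ⟨C, c, hc, hle⟩ := H.exists_sq_add_sq_le hl
  have hlim : Tendsto (fun t : ℝ => C * Real.exp (-c * t)) atTop (𝓝 0) := by
    have : Tendsto (fun t : ℝ => -c * t) atTop atBot :=
      tendsto_id.const_mul_atTop_of_neg (by linarith)
    simpa using (Real.tendsto_exp_atBot.comp this).const_mul C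
  have key (f : ℝ → ℝ) (hf : ∀ t, f t ^ 2 ≤ g t ^ 2 + h t ^ 2) : Tendsto f atTop (𝓝 0) := by
    have h2 : Tendsto (fun t => f t ^ 2) atTop (𝓝 0) := by
      refine squeeze_zero' (.of_forall fun t => sq_nonneg _) ?_ hlim
      filter_upwards [eventually_ge_atTop 0] with t ht using (hf t).trans (hle t ht)
    have h3 := h2.sqrt
    simp only [Real.sqrt_sq_eq_abs, Real.sqrt_zero] at h3
    exact (tendsto_zero_iff_abs_tendsto_zero f).2 h3
  exact ⟨key g fun t => by nlinarith [sq_nonneg (h t)],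
    key h fun t => by nlinarith [sq_nonneg (g t)]⟩

/-- Since (h + l g)' = -l g, the function (h + l g)² / (2 l) + g² / 2 has derivative -l g². It falls
from 1 / (2 l) at time 0 to 0 at infinity. -/
lemma tendsto_integral_sq (H : IsImpulseResponse l g h) (hl : 0 < l) :
    Tendsto (fun t => ∫ s in (0 : ℝ)..t, g s ^ 2) atTop (𝓝 (1 / (2 * l ^ 2))) := by
  have hd (t : ℝ) : HasDerivAt
      (fun t => -((h t + l * g t) ^ 2 / (2 * l) + g t ^ 2 / 2) / l) (g t ^ 2) t := by
    have h1 := H.deriv_left t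
    have h2 := H.deriv_right t
    have h3 := (((((h2.add (h1.const_mul l)).pow 2).div_const (2 * l)).add
      ((h1.pow 2).div_const 2)).neg).div_const l
    refine h3.congr_deriv ?_
    simp only [Pi.add_apply]
    field_simp
    push_cast
    ring
  have he (t : ℝ) := intervalIntegral.integral_eq_sub_of_hasDerivAt (a := 0) (b := t)
    (fun s _ => hd s) ((H.continuous_left.pow 2).intervalIntegrable _ _)
  simp only [he]
  obtain ⟨h1, h2⟩ := H.tendsto_left hl
  have := (((((h2.add (h1.const_mul l)).pow 2).div_const (2 * l)).add
      ((h1.pow 2).div_const 2)).neg).div_const l |>.sub_const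
        (-((h 0 + l * g 0) ^ 2 / (2 * l) + g 0 ^ 2 / 2) / l)
  convert this using 2
  rw [H.zero_left, H.zero_right]
  field_simp
  ring

end IsImpulseResponse

/-! ### Integration by parts against the integrated noise -/

/-- Variation of constants for `z' = v`, `v' = -l z - l v + b'`, with `b'` integrated by parts. -/
lemma IsImpulseResponse.variation_of_constants {l : ℝ} {g h : ℝ → ℝ} (H : IsImpulseResponse l g h)
    {z v b : ℝ → ℝ} (hz : Continuous z) (hv : Continuous v)
    (hz_eq : ∀ t, 0 ≤ t → z t = z 0 + ∫ s in (0 : ℝ)..t, v s)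
    (hv_eq : ∀ t, 0 ≤ t → v t = v 0 + (∫ s in (0 : ℝ)..t, (-l * z s - l * v s)) + b t)
    {t : ℝ} (ht : 0 ≤ t) :
    z t = (l * g t + h t) * z 0 + g t * v 0 + ∫ s in (0 : ℝ)..t, h (t - s) * b s := by
  have hg := H.continuous_left
  have hh := H.continuous_right
  let Z : ℝ → ℝ := fun t => z 0 + ∫ s in (0 : ℝ)..t, v s
  -- U equals v - b for nonnegative times: it is differentiable although v and b need not be.
  let U : ℝ → ℝ := fun t => v 0 + ∫ s in (0 : ℝ)..t, (-l * z s - l * v s)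
  have hZ (s : ℝ) : HasDerivAt Z (v s) s :=
    (intervalIntegral.integral_hasDerivAt_right (hv.intervalIntegrable _ _)
      hv.aestronglyMeasurable.stronglyMeasurableAtFilter hv.continuousAt).const_add _
  have hc : Continuous fun s => -l * z s - l * v s := by fun_prop
  have hU (s : ℝ) : HasDerivAt U (-l * z s - l * v s) s :=
    (intervalIntegral.integral_hasDerivAt_right (hc.intervalIntegrable _ _)
      hc.aestronglyMeasurable.stronglyMeasurableAtFilter hc.continuousAt).const_add _
  have hZc : Continuous Z := continuous_iff_continuousAt.2 fun s => (hZ s).continuousAt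
  have hUc : Continuous U := continuous_iff_continuousAt.2 fun s => (hU s).continuousAt
  have hg' (s : ℝ) : HasDerivAt (fun s => g (t - s)) (-h (t - s)) s :=
    (H.deriv_left (t - s)).comp_const_sub t s
  have hh' (s : ℝ) : HasDerivAt (fun s => h (t - s)) (-(-l * g (t - s) - l * h (t - s))) s :=
    (H.deriv_right (t - s)).comp_const_sub t s
  -- The derivative of (l g(t-s) + h(t-s)) Z(s) + g(t-s) U(s) collapses to h(t-s) (v - U) = h(t-s)
  -- b(s) on [0, t].
  have hF (s : ℝ) := ((((hg' s).const_mul l).add (hh' s)).mul (hZ s)).add ((hg' s).mul (hU s))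
  have key := intervalIntegral.integral_eq_sub_of_hasDerivAt (a := 0) (b := t)
    (fun s _ => hF s) (Continuous.intervalIntegrable (by simp only [Pi.add_apply]; fun_prop) _ _)
  have hcongr : ∫ s in (0 : ℝ)..t, h (t - s) * b s = _ :=
    (intervalIntegral.integral_congr fun s hs => ?_).trans key
  · rw [hcongr, hz_eq t ht]
    simp only [Pi.add_apply, Pi.mul_apply, sub_self, sub_zero, H.zero_left, H.zero_right, Z, U,
      intervalIntegral.integral_same]
    ring
  · have hs0 : 0 ≤ s := by
      rw [Set.uIcc_of_le ht] at hs
      exact hs.1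
    have h1 : Z s = z s := (hz_eq s hs0).symm
    have h2 : U s = v s - b s := by rw [hv_eq s hs0]; simp [U]
    simp only [Pi.add_apply, h1, h2]
    ring

/-- The variance `∫∫ k s k r min(s, r)` of `∫ k dB`-type integrals, after integration by parts. -/
lemma integral_mul_integral_mul_min {q k : ℝ → ℝ} (hq : ∀ s, HasDerivAt q (-k s) s)
    (hk : Continuous k) {t : ℝ} (hqt : q t = 0) (ht : 0 ≤ t) :
    ∫ s in (0 : ℝ)..t, ∫ r in (0 : ℝ)..t, k s * k r * min s r = ∫ s in (0 : ℝ)..t, q s ^ 2 := by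
  have hqc : Continuous q := continuous_iff_continuousAt.2 fun s => (hq s).continuousAt
  let M : ℝ → ℝ := fun s => ∫ r in (0 : ℝ)..s, q r
  have hM (s : ℝ) : HasDerivAt M (q s) s :=
    intervalIntegral.integral_hasDerivAt_right (hqc.intervalIntegrable _ _)
      hqc.aestronglyMeasurable.stronglyMeasurableAtFilter hqc.continuousAt
  have hMc : Continuous M := continuous_iff_continuousAt.2 fun s => (hM s).continuousAt
  -- Splitting at r = s removes the minimum; the boundary terms q(s) s cancel and q(t) = 0.
  have inner (s : ℝ) (hs : s ∈ Set.Icc 0 t) :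
      ∫ r in (0 : ℝ)..t, k r * min s r = M s := by
    have hc : Continuous fun r => k r * min s r := by fun_prop
    rw [← intervalIntegral.integral_add_adjacent_intervals (hc.intervalIntegrable 0 s)
      (hc.intervalIntegrable s t)]
    have e1 : ∫ r in (0 : ℝ)..s, k r * min s r = ∫ r in (0 : ℝ)..s, k r * r := by
      refine intervalIntegral.integral_congr fun r hr => ?_
      rw [Set.uIcc_of_le hs.1] at hr
      simp [min_eq_right hr.2]
    have e2 : ∫ r in s..t, k r * min s r = ∫ r in s..t, k r * s := by
      refine intervalIntegral.integral_congr fun r hr => ?_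
      rw [Set.uIcc_of_le hs.2] at hr
      simp [min_eq_left hr.1]
    have d1 (r : ℝ) : HasDerivAt (fun r => M r - q r * r) (k r * r) r := by
      refine ((hM r).sub ((hq r).mul (hasDerivAt_id r))).congr_deriv ?_
      simp
    have d2 (r : ℝ) : HasDerivAt (fun r => -(q r * s)) (k r * s) r := by
      refine ((hq r).mul_const s).neg.congr_deriv ?_
      ring
    rw [e1, e2, intervalIntegral.integral_eq_sub_of_hasDerivAt (fun r _ => d1 r)
        (Continuous.intervalIntegrable (by fun_prop) _ _),
      intervalIntegral.integral_eq_sub_of_hasDerivAt (fun r _ => d2 r)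
        (Continuous.intervalIntegrable (by fun_prop) _ _)]
    simp [M, hqt]
  have e : ∫ s in (0 : ℝ)..t, ∫ r in (0 : ℝ)..t, k s * k r * min s r =
      ∫ s in (0 : ℝ)..t, k s * M s := by
    refine intervalIntegral.integral_congr fun s hs => ?_
    rw [Set.uIcc_of_le ht] at hs
    simp only [mul_assoc]
    rw [intervalIntegral.integral_const_mul, inner s hs]
  have d (s : ℝ) : HasDerivAt (fun s => -(q s * M s)) (k s * M s - q s ^ 2) s := by
    refine ((hq s).mul (hM s)).neg.congr_deriv ?_
    ring
  have h0 := intervalIntegral.integral_eq_sub_of_hasDerivAt (a := 0) (b := t) (fun s _ => d s)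
    (Continuous.intervalIntegrable (by fun_prop) _ _)
  rw [intervalIntegral.integral_sub (Continuous.intervalIntegrable (by fun_prop) _ _)
    (Continuous.intervalIntegrable (by fun_prop) _ _)] at h0
  simp only [hqt, M, intervalIntegral.integral_same, mul_zero, zero_mul, sub_self] at h0
  rw [e]
  exact sub_eq_zero.1 h0

/-! ### Second moments of random integrals -/

section Probability

variable {Ω : Type*} [MeasurableSpace Ω] {P : Measure Ω}

/-- An almost surely continuous process with a.e. measurable marginals is indistinguishable from
one with continuous paths and measurable marginals. -/
lemma exists_continuous_measurable_process {b : ℝ≥0 → Ω → ℝ} (hm : ∀ s, AEMeasurable (b s) P)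
    (hc : ∀ᵐ ω ∂P, Continuous fun s => b s ω) :
    ∃ B : ℝ≥0 → Ω → ℝ, (∀ ω, Continuous fun s => B s ω) ∧ (∀ s, Measurable (B s)) ∧
      ∀ᵐ ω ∂P, ∀ s, B s ω = b s ω := by
  let d : ℕ → ℝ≥0 := TopologicalSpace.denseSeq ℝ≥0
  have hev : ∀ᵐ ω ∂P, (Continuous fun s => b s ω) ∧ ∀ n, b (d n) ω = (hm (d n)).mk _ ω :=
    hc.and (ae_all_iff.2 fun n => (hm (d n)).ae_eq_mk)
  -- The process is set to zero on a measurable null set containing all bad paths. Measurability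
  -- then holds on a dense set of times and passes to every time by continuity.
  obtain ⟨N, hN, hNm, hN0⟩ := exists_measurable_superset_of_null (ae_iff.1 hev)
  have hgood (ω : Ω) (hω : ω ∈ Nᶜ) :
      (Continuous fun s => b s ω) ∧ ∀ n, b (d n) ω = (hm (d n)).mk _ ω := by
    by_contra hcon
    exact hω (hN hcon)
  have hcont (ω : Ω) : Continuous fun s => Nᶜ.indicator (b s) ω := by
    by_cases hω : ω ∈ Nᶜ
    · simpa only [Set.indicator_of_mem hω] using (hgood ω hω).1
    · simpa only [Set.indicator_of_notMem hω] using continuous_const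
  have hmeas (n : ℕ) : Measurable (Nᶜ.indicator (b (d n))) := by
    have : Nᶜ.indicator (b (d n)) = Nᶜ.indicator ((hm (d n)).mk _) :=
      Set.indicator_congr fun ω hω => (hgood ω hω).2 n
    rw [this]
    exact (hm (d n)).measurable_mk.indicator hNm.compl
  refine ⟨fun s => Nᶜ.indicator (b s), hcont, fun s => ?_, ?_⟩
  · obtain ⟨y, hy, hys⟩ := mem_closure_iff_seq_limit.1
      (TopologicalSpace.denseRange_denseSeq ℝ≥0 s)
    refine measurable_of_tendsto_metrizable (f := fun n => Nᶜ.indicator (b (y n))) (fun n => ?_)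
      (tendsto_pi_nhds.2 fun ω => ((hcont ω).tendsto s).comp hys)
    obtain ⟨m, hm'⟩ := hy n
    rw [← hm']
    exact hmeas m
  · filter_upwards [measure_eq_zero_iff_ae_notMem.1 hN0] with ω hω s
    exact Set.indicator_of_mem hω _

/-- Second moment of a random integral. -/
lemma memLp_integral_and_integral_sq [IsProbabilityMeasure P] {α : Type*} [MeasurableSpace α]
    {μ : Measure α} [IsFiniteMeasure μ] {F : α → Ω → ℝ} (hF : Measurable (Function.uncurry F))
    (hL2 : ∀ s, MemLp (F s) 2 P) {M : ℝ} (hM : ∀ᵐ s ∂μ, ∫ ω, F s ω ^ 2 ∂P ≤ M) :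
    MemLp (fun ω => ∫ s, F s ω ∂μ) 2 P ∧
      ∫ ω, (∫ s, F s ω ∂μ) ^ 2 ∂P = ∫ s, ∫ r, ∫ ω, F s ω * F r ω ∂P ∂μ ∂μ := by
  let K : α × α → Ω → ℝ := fun p ω => F p.1 ω * F p.2 ω
  have hK : Measurable (Function.uncurry K) :=
    (hF.comp ((measurable_fst.comp measurable_fst).prodMk measurable_snd)).mul
      (hF.comp ((measurable_snd.comp measurable_fst).prodMk measurable_snd))
  have hKint : Integrable (Function.uncurry K) ((μ.prod μ).prod P) := by
    rw [integrable_prod_iff hK.aestronglyMeasurable]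
    refine ⟨.of_forall fun p => (hL2 p.1).integrable_mul (hL2 p.2), ?_⟩
    refine Integrable.of_bound (hK.norm.stronglyMeasurable.integral_prod_right
      ).aestronglyMeasurable M ?_
    have h1 : ∀ᵐ p ∂(μ.prod μ), ∫ ω, F p.1 ω ^ 2 ∂P ≤ M :=
      Measure.quasiMeasurePreserving_fst.ae hM
    have h2 : ∀ᵐ p ∂(μ.prod μ), ∫ ω, F p.2 ω ^ 2 ∂P ≤ M :=
      Measure.quasiMeasurePreserving_snd.ae hM
    filter_upwards [h1, h2] with p h1 h2
    rw [Real.norm_of_nonneg (integral_nonneg fun _ => norm_nonneg _)]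
    have i1 := (hL2 p.1).integrable_sq
    have i2 := (hL2 p.2).integrable_sq
    calc ∫ ω, ‖F p.1 ω * F p.2 ω‖ ∂P ≤ ∫ ω, (F p.1 ω ^ 2 + F p.2 ω ^ 2) / 2 ∂P := by
          refine integral_mono ((hL2 p.1).integrable_mul (hL2 p.2)).norm
            ((i1.add i2).div_const 2) fun ω => ?_
          simp only [norm_mul, Real.norm_eq_abs]
          nlinarith [sq_nonneg (|F p.1 ω| - |F p.2 ω|), sq_abs (F p.1 ω), sq_abs (F p.2 ω)]
      _ ≤ M := by
          rw [integral_div, integral_add i1 i2]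
          linarith
  have hsq (ω : Ω) : (∫ s, F s ω ∂μ) ^ 2 = ∫ p, K p ω ∂(μ.prod μ) := by
    rw [integral_prod_mul (fun s => F s ω) (fun s => F s ω), sq]
  have hY : Measurable fun ω => ∫ s, F s ω ∂μ :=
    hF.stronglyMeasurable.integral_prod_left.measurable
  refine ⟨(memLp_two_iff_integrable_sq hY.aestronglyMeasurable).2 ?_, ?_⟩
  · simp only [hsq]
    exact hKint.integral_prod_right
  · simp only [hsq]
    rw [← integral_integral_swap hKint]
    exact integral_prod (fun p => ∫ ω, K p ω ∂P) hKint.integral_prod_left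

end Probability

/-! ### Steady-state variance of one mode -/

section Probability

variable {Ω : Type*} [MeasurableSpace Ω] {P : Measure Ω}

/-- A decaying square-integrable perturbation does not change the limit of second moments. -/
lemma tendsto_integral_sq_add {ι : Type*} {f : Filter ι} {a c : ι → ℝ} {ξ η : Ω → ℝ}
    {Y : ι → Ω → ℝ} {m : ℝ} (ha : Tendsto a f (𝓝 0)) (hc : Tendsto c f (𝓝 0))
    (hξ : MemLp ξ 2 P) (hη : MemLp η 2 P) (hY : ∀ t, MemLp (Y t) 2 P)
    (hm : Tendsto (fun t => ∫ ω, Y t ω ^ 2 ∂P) f (𝓝 m)) :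
    Tendsto (fun t => ∫ ω, (a t * ξ ω + c t * η ω + Y t ω) ^ 2 ∂P) f (𝓝 m) := by
  have hexp (t : ι) : ∫ ω, (a t * ξ ω + c t * η ω + Y t ω) ^ 2 ∂P =
      a t ^ 2 * ∫ ω, ξ ω ^ 2 ∂P + c t ^ 2 * ∫ ω, η ω ^ 2 ∂P + 2 * (a t * c t) * ∫ ω, ξ ω * η ω ∂P
        + 2 * (a t * ∫ ω, ξ ω * Y t ω ∂P) + 2 * (c t * ∫ ω, η ω * Y t ω ∂P)
        + ∫ ω, Y t ω ^ 2 ∂P := by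
    have e (ω : Ω) : (a t * ξ ω + c t * η ω + Y t ω) ^ 2 =
        a t ^ 2 * ξ ω ^ 2 + c t ^ 2 * η ω ^ 2 + 2 * (a t * c t) * (ξ ω * η ω)
          + 2 * a t * (ξ ω * Y t ω) + 2 * c t * (η ω * Y t ω) + Y t ω ^ 2 := by ring
    have i1 := hξ.integrable_sq.const_mul (a t ^ 2)
    have i2 := hη.integrable_sq.const_mul (c t ^ 2)
    have i3 := (hξ.integrable_mul hη).const_mul (2 * (a t * c t))
    have i4 := (hξ.integrable_mul (hY t)).const_mul (2 * a t)
    have i5 := (hη.integrable_mul (hY t)).const_mul (2 * c t)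
    simp only [e]
    rw [integral_add, integral_add, integral_add, integral_add, integral_add]
    · simp only [integral_const_mul]
      ring
    exacts [i1, i2, i1.add i2, i3, (i1.add i2).add i3, i4, ((i1.add i2).add i3).add i4, i5,
      (((i1.add i2).add i3).add i4).add i5, (hY t).integrable_sq]
  -- The bound |ξ Y| ≤ ξ² + Y² and the convergent second moment of Y suffice, so no independence is
  -- needed.
  have cross {a : ι → ℝ} (ha : Tendsto a f (𝓝 0)) {ξ : Ω → ℝ} (hξ : MemLp ξ 2 P) :
      Tendsto (fun t => a t * ∫ ω, ξ ω * Y t ω ∂P) f (𝓝 0) := by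
    have hb : Tendsto (fun t => |a t| * (∫ ω, ξ ω ^ 2 ∂P + ∫ ω, Y t ω ^ 2 ∂P)) f (𝓝 0) := by
      simpa using ha.abs.mul (hm.const_add (∫ ω, ξ ω ^ 2 ∂P))
    refine squeeze_zero_norm (fun t => ?_) hb
    rw [norm_mul, Real.norm_eq_abs]
    gcongr
    rw [← integral_add hξ.integrable_sq (hY t).integrable_sq]
    refine norm_integral_le_of_norm_le (hξ.integrable_sq.add (hY t).integrable_sq)
      (.of_forall fun ω => ?_)
    rw [norm_mul, Real.norm_eq_abs, Real.norm_eq_abs]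
    nlinarith [sq_nonneg (|ξ ω| - |Y t ω|), sq_abs (ξ ω), sq_abs (Y t ω), sq_nonneg (ξ ω),
      sq_nonneg (Y t ω)]
  simp only [hexp]
  simpa using ((((((ha.pow 2).mul_const _).add ((hc.pow 2).mul_const _)).add
    (((ha.mul hc).const_mul 2).mul_const _)).add ((cross ha hξ).const_mul 2)).add
    ((cross hc hη).const_mul 2)).add hm

/-- The steady-state variance of a single mode `z'' + l z' + l z = b'` with white noise `b'`. -/
lemma memLp_and_tendsto_of_mode [IsProbabilityMeasure P] {l : ℝ} (hl : 0 < l)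
    {z v b : ℝ≥0 → Ω → ℝ} (hz : ∀ᵐ ω ∂P, Continuous fun t => z t ω)
    (hv : ∀ᵐ ω ∂P, Continuous fun t => v t ω) (hb : ∀ᵐ ω ∂P, Continuous fun t => b t ω)
    (hz_eq : ∀ᵐ ω ∂P, ∀ t : ℝ≥0, z t ω = z 0 ω + ∫ s in (0 : ℝ)..t, v s.toNNReal ω)
    (hv_eq : ∀ᵐ ω ∂P, ∀ t : ℝ≥0, v t ω = v 0 ω
      + (∫ s in (0 : ℝ)..t, (-l * z s.toNNReal ω - l * v s.toNNReal ω)) + b t ω)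
    (hb2 : ∀ t, MemLp (b t) 2 P) (hcov : ∀ s t, ∫ ω, b s ω * b t ω ∂P = min s t)
    (hz0 : MemLp (z 0) 2 P) (hv0 : MemLp (v 0) 2 P) :
    (∀ t, MemLp (z t) 2 P) ∧
      Tendsto (fun t => ∫ ω, z t ω ^ 2 ∂P) atTop (𝓝 (1 / (2 * l ^ 2))) := by
  obtain ⟨g, h, H⟩ := exists_isImpulseResponse l
  have hhc := H.continuous_right
  obtain ⟨B, hBc, hBm, hBb⟩ := exists_continuous_measurable_process
    (fun s => (hb2 s).aestronglyMeasurable.aemeasurable) hb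
  have hBae (s : ℝ≥0) : b s =ᵐ[P] B s := by
    filter_upwards [hBb] with ω hω using (hω s).symm
  have hB2 (s : ℝ≥0) : MemLp (B s) 2 P := (hb2 s).ae_eq (hBae s)
  have hBcov (s t : ℝ≥0) : ∫ ω, B s ω * B t ω ∂P = min s t := by
    rw [← hcov s t]
    refine integral_congr_ae ?_
    filter_upwards [hBb] with ω hω
    rw [hω, hω]
  have hBmeas : Measurable fun p : ℝ≥0 × Ω => B p.1 p.2 :=
    measurable_uncurry_of_continuous_of_measurable (u := B) hBc hBm
  let Y : ℝ≥0 → Ω → ℝ := fun t ω => ∫ s in (0 : ℝ)..t, h (t - s) * B s.toNNReal ω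
  have hY (t : ℝ≥0) : MemLp (Y t) 2 P ∧ ∫ ω, Y t ω ^ 2 ∂P = ∫ s in (0 : ℝ)..t, g s ^ 2 := by
    obtain ⟨K, hK⟩ := (isCompact_Icc (a := (0 : ℝ)) (b := t)).exists_bound_of_continuousOn
      (f := fun s => h (t - s)) (by fun_prop)
    have hF : Measurable (Function.uncurry fun (s : ℝ) ω => h (t - s) * B s.toNNReal ω) := by
      refine Measurable.mul ?_ (hBmeas.comp ((measurable_real_toNNReal.comp
        measurable_fst).prodMk measurable_snd))
      exact (hhc.comp (by fun_prop : Continuous fun p : ℝ => t - p)).measurable.comp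
        measurable_fst
    have hFF (s r : ℝ) : ∫ ω, h (t - s) * B s.toNNReal ω * (h (t - r) * B r.toNNReal ω) ∂P =
        h (t - s) * h (t - r) * (min s.toNNReal r.toNNReal : ℝ≥0) := by
      rw [← hBcov, ← integral_const_mul]
      congr with ω
      ring
    have hbound : ∀ᵐ s ∂(volume.restrict (Set.Ioc 0 (t : ℝ))),
        ∫ ω, (h (t - s) * B s.toNNReal ω) ^ 2 ∂P ≤ K ^ 2 * t := by
      filter_upwards [ae_restrict_mem measurableSet_Ioc] with s hs
      simp only [sq (h (t - s) * B s.toNNReal _)]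
      rw [hFF, min_self, Real.coe_toNNReal s hs.1.le, ← sq]
      have := hK s ⟨hs.1.le, hs.2⟩
      rw [Real.norm_eq_abs] at this
      have h2 : h (t - s) ^ 2 ≤ K ^ 2 := by
        rw [← sq_abs]
        gcongr
      exact mul_le_mul h2 hs.2 hs.1.le (sq_nonneg _)
    obtain ⟨h1, h2⟩ := memLp_integral_and_integral_sq (P := P) hF
      (fun s => (hB2 s.toNNReal).const_mul (h (t - s))) hbound
    have hYeq : Y t = fun ω => ∫ s, h (t - s) * B s.toNNReal ω
        ∂(volume.restrict (Set.Ioc 0 (t : ℝ))) :=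
      funext fun ω => intervalIntegral.integral_of_le t.coe_nonneg
    rw [hYeq]
    refine ⟨h1, h2.trans ?_⟩
    -- The kernel h(t-s) is minus the derivative of q(s) = g(t-s), and q(t) = g(0) = 0.
    have hgt (s : ℝ) : HasDerivAt (fun s => g (t - s)) (-h (t - s)) s :=
      (H.deriv_left (t - s)).comp_const_sub (t : ℝ) s
    have h3 := integral_mul_integral_mul_min hgt (by fun_prop) (by simp [H.zero_left]) t.coe_nonneg
    rw [intervalIntegral.integral_comp_sub_left (fun s => g s ^ 2) (t : ℝ), sub_self,
      sub_zero] at h3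
    rw [← h3, intervalIntegral.integral_of_le t.coe_nonneg]
    refine setIntegral_congr_fun measurableSet_Ioc fun s hs => ?_
    rw [intervalIntegral.integral_of_le t.coe_nonneg]
    refine setIntegral_congr_fun measurableSet_Ioc fun r hr => ?_
    rw [hFF, NNReal.coe_min, Real.coe_toNNReal s hs.1.le, Real.coe_toNNReal r hr.1.le]
  have hrep (t : ℝ≥0) :
      z t =ᵐ[P] fun ω => (l * g t + h t) * z 0 ω + g t * v 0 ω + Y t ω := by
    filter_upwards [hz, hv, hz_eq, hv_eq, hBb] with ω hz hv hz_eq hv_eq hBb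
    have := H.variation_of_constants (z := fun s => z s.toNNReal ω) (v := fun s => v s.toNNReal ω)
      (b := fun s => b s.toNNReal ω) (hz.comp continuous_real_toNNReal)
      (hv.comp continuous_real_toNNReal)
      (fun s hs => by simpa [Real.coe_toNNReal s hs] using hz_eq s.toNNReal)
      (fun s hs => by simpa [Real.coe_toNNReal s hs] using hv_eq s.toNNReal) t.coe_nonneg
    simpa [Y, hBb] using this
  obtain ⟨hg0, hh0⟩ := H.tendsto_left hl
  have hcoe : Tendsto (fun t : ℝ≥0 => (t : ℝ)) atTop atTop := NNReal.tendsto_coe_atTop.2 tendsto_id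
  constructor
  · intro t
    exact (((hz0.const_mul _).add (hv0.const_mul _)).add (hY t).1).ae_eq (hrep t).symm
  · have hlim := tendsto_integral_sq_add (f := atTop) (a := fun t : ℝ≥0 => l * g t + h t)
      (c := fun t : ℝ≥0 => g t) (Y := Y)
      (by simpa [Function.comp_def] using (((hg0.const_mul l).add hh0).comp hcoe)) (hg0.comp hcoe) hz0 hv0
      (fun t => (hY t).1)
      (by simpa only [(hY _).2] using! (H.tendsto_integral_sq hl).comp hcoe)
    refine hlim.congr fun t => integral_congr_ae ?_
    filter_upwards [hrep t] with ω hω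
    rw [hω]

lemma IsUncorrelatedBrownian.memLp {V : Type*} {W : V → ℝ≥0 → Ω → ℝ}
    (hW : IsUncorrelatedBrownian W P) (j : V) (t : ℝ≥0) :
    MemLp (W j t) 2 P := by
  have h := (hW.brownian j).hasLaw_eval t
  refine (memLp_map_measure_iff aestronglyMeasurable_id h.aemeasurable).1 ?_
  rw [h.map_eq]
  exact memLp_id_gaussianReal 2

lemma IsUncorrelatedBrownian.integral_mul [IsProbabilityMeasure P] {V : Type*}
    [DecidableEq V] {W : V → ℝ≥0 → Ω → ℝ} (hW : IsUncorrelatedBrownian W P) (i j : V) (s t : ℝ≥0) :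
    ∫ ω, W i s ω * W j t ω ∂P = if i = j then (min s t : ℝ) else 0 := by
  have h : cov[W i s, W j t; P] = ∫ ω, W i s ω * W j t ω ∂P := by
    rw [covariance_eq_sub (hW.memLp i s) (hW.memLp j t), (hW.brownian i).integral_eval s,
      zero_mul, sub_zero]
    rfl
  rw [← h]
  split_ifs with hij
  · subst hij
    exact (hW.brownian i).covariance_eval s t
  · exact hW.uncorrelated i j hij s t

end Probability

/-! ### Laplacian eigenbasis and removal of the average -/

section Spectral

variable {V : Type*} [Fintype V] [DecidableEq V] (G : SimpleGraph V) [DecidableRel G.Adj]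

/-- The coordinate of `y` along the `i`-th orthonormal eigenvector of the Laplacian. -/
noncomputable def modeCoord (i : V) (y : V → ℝ) : ℝ :=
  ∑ j, (G.isHermitian_lapMatrix ℝ).eigenvectorBasis i j * y j

lemma modeCoord_eq_inner (i : V) (y : V → ℝ) :
    modeCoord G i y = inner ℝ ((G.isHermitian_lapMatrix ℝ).eigenvectorBasis i)
      (WithLp.toLp 2 y) := by
  simp [modeCoord, PiLp.inner_apply, mul_comm]

lemma modeCoord_mulVec_lapMatrix (i : V) (y : V → ℝ) :
    modeCoord G i (Matrix.mulVec (G.lapMatrix ℝ) y) =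
      (G.isHermitian_lapMatrix ℝ).eigenvalues i * modeCoord G i y := by
  have h1 := (G.isHermitian_lapMatrix ℝ).mulVec_eigenvectorBasis i
  have h2 : modeCoord G i (Matrix.mulVec (G.lapMatrix ℝ) y) =
      ⇑((G.isHermitian_lapMatrix ℝ).eigenvectorBasis i) ⬝ᵥ Matrix.mulVec (G.lapMatrix ℝ) y := rfl
  have h3 : (G.lapMatrix ℝ).transpose = G.lapMatrix ℝ := SimpleGraph.isSymm_lapMatrix ..
  rw [h2, Matrix.dotProduct_mulVec, ← Matrix.mulVec_transpose, h3, h1,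
    smul_dotProduct]
  rfl

lemma sum_modeCoord_mul (y : V → ℝ) (j : V) :
    ∑ i, modeCoord G i y * (G.isHermitian_lapMatrix ℝ).eigenvectorBasis i j = y j := by
  have := (G.isHermitian_lapMatrix ℝ).eigenvectorBasis.sum_repr' (WithLp.toLp 2 y)
  have := congrArg (fun w : EuclideanSpace ℝ V => w j) this
  simpa [modeCoord_eq_inner] using this

lemma sum_modeCoord_sq (y : V → ℝ) : ∑ i, modeCoord G i y ^ 2 = ∑ j, y j ^ 2 := by
  have := (G.isHermitian_lapMatrix ℝ).eigenvectorBasis.sum_sq_norm_inner_right (WithLp.toLp 2 y)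
  simpa [modeCoord_eq_inner, EuclideanSpace.real_norm_sq_eq] using this

lemma sum_eigenvectorBasis_sq (i : V) :
    ∑ j, (G.isHermitian_lapMatrix ℝ).eigenvectorBasis i j ^ 2 = 1 := by
  rw [← EuclideanSpace.real_norm_sq_eq, OrthonormalBasis.norm_eq_one, one_pow]

/-- Removing the average kills exactly the modes with eigenvalue zero. -/
lemma modeCoord_sub_average (hG : G.Connected) (i : V) (y : V → ℝ) :
    modeCoord G i (fun j => y j - 1 / (Fintype.card V : ℝ) * ∑ k, y k) =
      if (G.isHermitian_lapMatrix ℝ).eigenvalues i ≠ 0 then modeCoord G i y else 0 := by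
  have := hG.nonempty
  have hsub (c : ℝ) : modeCoord G i (fun j => y j - c) =
      modeCoord G i y - c * modeCoord G i (fun _ => 1) := by
    simp only [modeCoord, mul_sub, Finset.sum_sub_distrib, Finset.mul_sum]
    congr 1
    exact Finset.sum_congr rfl fun j _ => by ring
  split_ifs with h
  -- Constants lie in the kernel of L, hence are orthogonal to eigenvectors of nonzero eigenvalue.
  · have h0 := modeCoord_mulVec_lapMatrix G i (fun _ => 1)
    rw [G.lapMatrix_mulVec_const_eq_zero] at h0
    have h1 : modeCoord G i (fun _ => 1) = 0 := by
      have : modeCoord G i 0 = 0 := by simp [modeCoord]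
      rw [this] at h0
      exact (mul_eq_zero.1 h0.symm).resolve_left h
    rw [hsub, h1, mul_zero, sub_zero]
  -- By connectedness a kernel eigenvector is constant, so it annihilates deviations, which sum to
  -- zero.
  · have h1 := (G.isHermitian_lapMatrix ℝ).mulVec_eigenvectorBasis i
    rw [not_not.1 h, zero_smul, G.lapMatrix_mulVec_eq_zero_iff_forall_reachable] at h1
    obtain ⟨j₀⟩ := hG.nonempty
    have hconst (j : V) := h1 j j₀ (hG.preconnected j j₀)
    simp only [modeCoord, hconst, ← Finset.mul_sum, Finset.sum_sub_distrib, Finset.sum_const,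
      Finset.card_univ, nsmul_eq_mul]
    have : (Fintype.card V : ℝ) ≠ 0 := by exact_mod_cast Fintype.card_ne_zero
    field_simp
    ring

end Spectral

variable {V : Type*} [Fintype V] [DecidableEq V] (G : SimpleGraph V) [DecidableRel G.Adj]
  {Ω : Type*} [MeasurableSpace Ω] {P : Measure Ω} {x : ℝ≥0 → Ω → V ⊕ V → ℝ} {W : V → ℝ≥0 → Ω → ℝ}

lemma sub_average_eq_sum (hG : G.Connected) (y : V → ℝ) (j : V) :
    y j - 1 / (Fintype.card V : ℝ) * ∑ k, y k =
      ∑ i with (G.isHermitian_lapMatrix ℝ).eigenvalues i ≠ 0,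
        modeCoord G i y * (G.isHermitian_lapMatrix ℝ).eigenvectorBasis i j := by
  rw [← sum_modeCoord_mul G (fun j => y j - 1 / (Fintype.card V : ℝ) * ∑ k, y k) j,
    Finset.sum_filter]
  refine Finset.sum_congr rfl fun i _ => ?_
  rw [modeCoord_sub_average G hG, ite_mul, zero_mul]

lemma sum_sub_average_sq (hG : G.Connected) (y : V → ℝ) :
    ∑ j, (y j - 1 / (Fintype.card V : ℝ) * ∑ k, y k) ^ 2 =
      ∑ i with (G.isHermitian_lapMatrix ℝ).eigenvalues i ≠ 0, modeCoord G i y ^ 2 := by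
  rw [← sum_modeCoord_sq G fun j => y j - 1 / (Fintype.card V : ℝ) * ∑ k, y k, Finset.sum_filter]
  refine Finset.sum_congr rfl fun i _ => ?_
  rw [modeCoord_sub_average G hG, ite_pow, zero_pow two_ne_zero]

lemma modeCoord_add (i : V) (y z : V → ℝ) :
    modeCoord G i (fun j => y j + z j) = modeCoord G i y + modeCoord G i z := by
  simp only [modeCoord, mul_add, Finset.sum_add_distrib]

lemma modeCoord_intervalIntegral (i : V) {f : ℝ → V → ℝ} (hf : Continuous f) (a b : ℝ) :
    modeCoord G i (fun j => ∫ s in a..b, f s j) = ∫ s in a..b, modeCoord G i (f s) := by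
  simp only [modeCoord]
  rw [intervalIntegral.integral_finsetSum]
  · simp only [intervalIntegral.integral_const_mul]
  · exact fun j _ => Continuous.intervalIntegrable (by fun_prop) _ _

lemma memLp_modeCoord (i : V) {f : V → Ω → ℝ} (hf : ∀ j, MemLp (f j) 2 P) :
    MemLp (fun ω => modeCoord G i fun j => f j ω) 2 P :=
  memLp_finsetSum _ fun j _ => (hf j).const_mul _

/-- Off-diagonal covariances vanish and the eigenvector has norm 1. Only the covariance of the modal
noise is needed later, not its law. -/
lemma IsUncorrelatedBrownian.integral_modeCoord_mul [IsProbabilityMeasure P]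
    (hW : IsUncorrelatedBrownian W P) (i : V) (s t : ℝ≥0) :
    ∫ ω, modeCoord G i (fun j => W j s ω) * modeCoord G i (fun j => W j t ω) ∂P = min s t := by
  simp only [modeCoord, Finset.sum_mul_sum]
  rw [integral_finsetSum]
  · have h (j : V) : ∫ ω, ∑ k, (G.isHermitian_lapMatrix ℝ).eigenvectorBasis i j * W j s ω *
        ((G.isHermitian_lapMatrix ℝ).eigenvectorBasis i k * W k t ω) ∂P =
        (G.isHermitian_lapMatrix ℝ).eigenvectorBasis i j ^ 2 * min s t := by
      rw [integral_finsetSum]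
      · simp only [mul_mul_mul_comm _ (W j s _), integral_const_mul, hW.integral_mul]
        simp [sq]
      · exact fun k _ => ((hW.memLp j s).const_mul _).integrable_mul ((hW.memLp k t).const_mul _)
    simp only [h]
    rw [← Finset.sum_mul, sum_eigenvectorBasis_sq, one_mul]
  · exact fun j _ => integrable_finsetSum _ fun k _ =>
      ((hW.memLp j s).const_mul _).integrable_mul ((hW.memLp k t).const_mul _)

/-! ### The dynamics in modal coordinates -/

variable {G}

lemma IsSolution.position_eq (hx : IsSolution G x W P) : ∀ᵐ ω ∂P, ∀ (t : ℝ≥0) (j : V),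
    x t ω (Sum.inl j) = x 0 ω (Sum.inl j)
      + ∫ s in (0 : ℝ)..t, x s.toNNReal ω (Sum.inr j) := by
  filter_upwards [hx.integral_eq] with ω h t j
  have := h t (Sum.inl j)
  simpa [driftMatrix, noiseMatrix, Matrix.fromBlocks_mulVec, Matrix.fromRows_mulVec] using this

lemma IsSolution.velocity_eq (hx : IsSolution G x W P) : ∀ᵐ ω ∂P, ∀ (t : ℝ≥0) (j : V),
    x t ω (Sum.inr j) = x 0 ω (Sum.inr j)
      + (∫ s in (0 : ℝ)..t,
          (-(Matrix.mulVec (G.lapMatrix ℝ) (fun k => x s.toNNReal ω (Sum.inl k)) j)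
          - Matrix.mulVec (G.lapMatrix ℝ) (fun k => x s.toNNReal ω (Sum.inr k)) j)) + W j t ω := by
  filter_upwards [hx.integral_eq] with ω h t j
  have := h t (Sum.inr j)
  simpa [driftMatrix, noiseMatrix, Matrix.fromBlocks_mulVec, Matrix.fromRows_mulVec,
    Function.comp_def, Matrix.neg_mulVec, sub_eq_add_neg] using this

lemma IsSolution.memLp_and_tendsto_modeCoord [IsProbabilityMeasure P] (hx : IsSolution G x W P)
    (hW : IsUncorrelatedBrownian W P) (hx0 : ∀ i, MemLp (fun ω => x 0 ω i) 2 P) (i : V)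
    (hi : (G.isHermitian_lapMatrix ℝ).eigenvalues i ≠ 0) :
    (∀ t, MemLp (fun ω => modeCoord G i fun j => x t ω (Sum.inl j)) 2 P) ∧
      Tendsto (fun t => ∫ ω, modeCoord G i (fun j => x t ω (Sum.inl j)) ^ 2 ∂P) atTop
        (𝓝 (1 / (2 * (G.isHermitian_lapMatrix ℝ).eigenvalues i ^ 2))) := by
  have hpos : 0 < (G.isHermitian_lapMatrix ℝ).eigenvalues i :=
    lt_of_le_of_ne ((SimpleGraph.posSemidef_lapMatrix ℝ G).eigenvalues_nonneg i) hi.symm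
  refine memLp_and_tendsto_of_mode hpos (v := fun t ω => modeCoord G i fun j => x t ω (Sum.inr j))
    (b := fun t ω => modeCoord G i fun j => W j t ω) ?_ ?_ ?_ ?_ ?_
    (fun t => memLp_modeCoord G i fun j => hW.memLp j t) (hW.integral_modeCoord_mul G i)
    (memLp_modeCoord G i fun j => hx0 _) (memLp_modeCoord G i fun j => hx0 _)
  · filter_upwards [hx.continuous_paths] with ω hc
    unfold modeCoord
    fun_prop
  · filter_upwards [hx.continuous_paths] with ω hc
    unfold modeCoord
    fun_prop
  · filter_upwards [ae_all_iff.2 fun j => (hW.brownian j).cont] with ω hc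
    unfold modeCoord
    fun_prop
  · filter_upwards [hx.continuous_paths, hx.position_eq] with ω hc h t
    have hc' : Continuous fun (s : ℝ) (j : V) => x s.toNNReal ω (Sum.inr j) :=
      continuous_pi fun j => (continuous_apply _).comp (hc.comp continuous_real_toNNReal)
    rw [← modeCoord_intervalIntegral G i hc', ← modeCoord_add]
    exact congrArg (modeCoord G i) (funext fun j => h t j)
  · filter_upwards [hx.continuous_paths, hx.velocity_eq] with ω hc h t
    have hl : Continuous fun (s : ℝ) (j : V) => x s.toNNReal ω (Sum.inl j) :=
      continuous_pi fun j => (continuous_apply _).comp (hc.comp continuous_real_toNNReal)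
    have hr : Continuous fun (s : ℝ) (j : V) => x s.toNNReal ω (Sum.inr j) :=
      continuous_pi fun j => (continuous_apply _).comp (hc.comp continuous_real_toNNReal)
    have hc' : Continuous fun (s : ℝ) (j : V) =>
        -(Matrix.mulVec (G.lapMatrix ℝ) (fun k => x s.toNNReal ω (Sum.inl k)) j)
          - Matrix.mulVec (G.lapMatrix ℝ) (fun k => x s.toNNReal ω (Sum.inr k)) j :=
      (continuous_const.matrix_mulVec hl).neg.sub (continuous_const.matrix_mulVec hr)
    have hmode (s : ℝ) :
        -(G.isHermitian_lapMatrix ℝ).eigenvalues i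
            * modeCoord G i (fun j => x s.toNNReal ω (Sum.inl j))
          - (G.isHermitian_lapMatrix ℝ).eigenvalues i
            * modeCoord G i (fun j => x s.toNNReal ω (Sum.inr j)) =
        modeCoord G i fun j =>
          -(Matrix.mulVec (G.lapMatrix ℝ) (fun k => x s.toNNReal ω (Sum.inl k)) j)
            - Matrix.mulVec (G.lapMatrix ℝ) (fun k => x s.toNNReal ω (Sum.inr k)) j := by
      rw [neg_mul, ← modeCoord_mulVec_lapMatrix, ← modeCoord_mulVec_lapMatrix]
      simp [modeCoord, mul_sub, Finset.sum_sub_distrib]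
    simp only [hmode]
    rw [← modeCoord_intervalIntegral G i hc', ← modeCoord_add, ← modeCoord_add]
    exact congrArg (modeCoord G i) (funext fun j => h t j)

end SecondOrderConsensus

open SecondOrderConsensus in
theorem mainTheorem6 {V : Type*} [Fintype V] [DecidableEq V]
    (G : SimpleGraph V) [DecidableRel G.Adj] (hG : G.Connected)
    {Ω : Type*} [MeasurableSpace Ω] (P : Measure Ω) [IsProbabilityMeasure P]
    (W : V → ℝ≥0 → Ω → ℝ) (hW : SecondOrderConsensus.IsUncorrelatedBrownian W P)
    (x : ℝ≥0 → Ω → V ⊕ V → ℝ) (hx : SecondOrderConsensus.IsSolution G x W P)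
    (hx0 : ∀ i, MemLp (fun ω => x 0 ω i) 2 P) :
    SecondOrderConsensus.HasTotalVariance x P
      (∑ i : V with (G.isHermitian_lapMatrix ℝ).eigenvalues i ≠ 0,
        1 / (2 * (G.isHermitian_lapMatrix ℝ).eigenvalues i ^ 2)) := by
  have key := hx.memLp_and_tendsto_modeCoord hW hx0
  have hdev (j : V) (t : ℝ≥0) : MemLp (deviation x j t) 2 P := by
    have e : deviation x j t = fun ω => ∑ i with (G.isHermitian_lapMatrix ℝ).eigenvalues i ≠ 0,
        modeCoord G i (fun k => x t ω (Sum.inl k)) *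
          (G.isHermitian_lapMatrix ℝ).eigenvectorBasis i j :=
      funext fun ω => sub_average_eq_sum G hG (fun k => x t ω (Sum.inl k)) j
    rw [e]
    exact memLp_finsetSum _ fun i hi =>
      ((key i (Finset.mem_filter.1 hi).2).1 t).mul_const _
  refine ⟨hdev, ?_⟩
  refine (tendsto_finsetSum _ fun i hi => (key i (Finset.mem_filter.1 hi).2).2).congr fun t => ?_
  rw [← integral_finsetSum _ fun i hi =>
      ((key i (Finset.mem_filter.1 hi).2).1 t).integrable_sq,
    ← integral_finsetSum _ fun j _ => (hdev j t).integrable_sq]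
  exact integral_congr_ae (.of_forall fun ω =>
    (sum_sub_average_sq G hG fun k => x t ω (Sum.inl k)).symm)
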